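/- Let $\Omega$ be an uncountable Polish space (e.g. $\mathbb{R}$ or $\mathbb{R}^{\mathbb{N}}$) and let $\mathcal{B}_\Omega$ be the $\sigma$-algebra of its universally measurable subsets. A quasi-universal space is a set $X$ with a set $X^\Omega$ of maps $\Omega\to X$ that contains all constant maps and is closed under precomposition with $\mathcal{B}_\Omega$-$\mathcal{B}_\Omega$-measurable maps $\Omega\to\Omega$; $\Omega^\Omega$ is the set of all these measurable maps. It carries the $\sigma$-algebra $\mathcal{B}(X^\Omega)=\{A\subseteq X : \alpha^{-1}(A)\in\mathcal{B}_\Omega \text{ for all } \alpha\in X^\Omega\}$. A map $h:Y\to X$ is quasi-measurable if $h\circ\alpha\in X^\Omega$ for all $\alpha\in Y^\Omega$, and $X^Y$ is the set of such maps. On a product $\prod_i X_i$, a map $\Omega\to\prod_i X_i$ belongs to $(\prod_i X_i)^\Omega$ iff all its components belong to the $X_i^\Omega$. Let $\mathcal{Q}(\Omega)$ be the set of probability measures $\mu$ on $\mathcal{B}_\Omega$ such that $\omega\mapsto\mu(D_\omega)$ is $\mathcal{B}_\Omega$-measurable for all $D\in\mathcal{B}(\Omega^\Omega\times\Omega^\Omega)$,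 where $D_\omega=\{\omega' : (\omega,\omega')\in D\}$, and let $\mathcal{Q}(\Omega)^\Omega$ be the set of maps $\kappa:\Omega\to\mathcal{Q}(\Omega)$ such that $\omega\mapsto\kappa(\varphi(\omega))(D_\omega)$ is $\mathcal{B}_\Omega$-measurable for all $\varphi\in\Omega^\Omega$ and all such $D$. For a quasi-universal space $X$ let $\mathcal{P}(X)$ be the quasi-universal space of push-forward probability measures on $\mathcal{B}(X^\Omega)$: $\mathcal{P}(X)=\{\alpha_*\nu : \alpha\in X^\Omega,\ \nu\in\mathcal{Q}(\Omega)\}$ and $\mathcal{P}(X)^\Omega=\{\omega\mapsto\alpha_*\kappa(\omega) : \alpha\in X^\Omega,\ \kappa\in\mathcal{Q}(\Omega)^\Omega\}$. A quasi-universal space $X$ is countably separated if countably many sets of $\mathcal{B}(X^\Omega)$ separate its points. It is universal if $X^\Omega$ is the set of all measurable maps $(\Omega,\mathcal{B}_\Omega)\to(X,\mathcal{B}(X^\Omega))$ and the universal completion of $(X,\mathcal{B}(X^\Omega))$ is isomorphic, as a measurable space, to a universally measurable subset of $\mathbb{R}$ with the $\sigma$-algebra that the universally measurable subsets of $\mathbb{R}$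 induce on it. **Theorem.** Let $(X_n)_{n\ge 0}$ and $Z$ be quasi-universal spaces such that either all $X_n$ are universal (and $Z$ is arbitrary), or all $X_n$ are countably separated and $Z$ is universal. Write $X_{0:n}=\prod_{k=0}^n X_k$ and $X_{\mathbb{N}}=\prod_{k\ge 0}X_k$, and let $\mathrm{pr}_{0:n}$ be the projections onto $X_{0:n}$. Let $Q_n\in\mathcal{P}(X_{0:n})^Z$, $n\ge 0$, be such that $\mathrm{pr}_{0:n,*}\,Q_{n+1}(z)=Q_n(z)$ for all $n\ge 0$ and $z\in Z$. Then there is a unique $Q\in\mathcal{P}(X_{\mathbb{N}})^Z$ such that $\mathrm{pr}_{0:n,*}\,Q(z)=Q_n(z)$ for all $n\ge 0$ and $z\in Z$. -/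

import Mathlib

open MeasureTheory

universe u v w

/-- The universal completion of a `σ`-algebra `m`: the sets that lie in the Lebesgue completion of `m`
with respect to every probability measure on `m`. -/
def universalCompletion {X : Type u} (m : MeasurableSpace X) : MeasurableSpace X where
  MeasurableSet' A := ∀ μ : Measure X, IsProbabilityMeasure μ → NullMeasurableSet A μ
  measurableSet_empty _ _ := nullMeasurableSet_empty
  measurableSet_compl _ hA μ hμ := (hA μ hμ).compl
  measurableSet_iUnion _ hA μ hμ := NullMeasurableSet.iUnion fun i => hA i μ hμ

/-- The `σ`-algebra of universally measurable subsets of a topological space. -/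
def univMeas (Ω : Type w) [TopologicalSpace Ω] : MeasurableSpace Ω :=
  universalCompletion (borel Ω)

/-- The set `𝓕(m)` of measurable maps from the sample space to a measurable space. -/
def measurableMaps (Ω : Type w) [TopologicalSpace Ω] {X : Type u} (m : MeasurableSpace X) :
    Set (Ω → X) :=
  {α | Measurable[univMeas Ω, m] α}

/-- A quasi-universal space with sample space `Ω` (an uncountable Polish space with its universally
measurable subsets): a set `X` with a set `X^Ω` of maps `Ω → X`, here `plots`, that contains the
constant maps and is stable under precomposition with universally measurable maps `Ω → Ω`. -/
structure QUS (Ω : Type w) [TopologicalSpace Ω] where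
  carrier : Type u
  plots : Set (Ω → carrier)
  comp_mem : ∀ α ∈ plots, ∀ φ ∈ measurableMaps Ω (univMeas Ω), α ∘ φ ∈ plots
  const_mem : ∀ x : carrier, (fun _ => x) ∈ plots

namespace QUS

variable {Ω : Type w} [TopologicalSpace Ω]

instance : CoeSort (QUS.{u} Ω) (Type u) := ⟨QUS.carrier⟩

/-- The induced `σ`-algebra `𝓑(X^Ω)` of a quasi-universal space. -/
instance sigma (X : QUS.{u} Ω) : MeasurableSpace X where
  MeasurableSet' A := ∀ α ∈ X.plots, MeasurableSet[univMeas Ω] (α ⁻¹' A)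
  measurableSet_empty _ _ := @MeasurableSet.empty _ (univMeas Ω)
  measurableSet_compl _ hA α hα := @MeasurableSet.compl _ _ (univMeas Ω) (hA α hα)
  measurableSet_iUnion A hA α hα := by
    rw [Set.preimage_iUnion]
    exact @MeasurableSet.iUnion _ _ (univMeas Ω) _ _ fun i => hA i α hα

/-- Quasi-measurable maps. -/
def IsQuasiMeasurable (X : QUS.{u} Ω) (Y : QUS.{v} Ω) (h : X → Y) : Prop :=
  ∀ α ∈ X.plots, h ∘ α ∈ Y.plots

/-- The set `Y^X` of quasi-measurable maps from `X` to `Y`. -/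
def Hom (X : QUS.{u} Ω) (Y : QUS.{v} Ω) : Type (max u v) :=
  {h : X → Y // IsQuasiMeasurable X Y h}

/-- The sample space as a quasi-universal space. -/
def sample (Ω : Type w) [TopologicalSpace Ω] : QUS.{w} Ω where
  carrier := Ω
  plots := measurableMaps Ω (univMeas Ω)
  comp_mem _ hα _ hφ := @Measurable.comp _ _ _ (univMeas Ω) (univMeas Ω) (univMeas Ω) _ _ hα hφ
  const_mem _ := @measurable_const _ _ (univMeas Ω) (univMeas Ω) _

/-- The product of two quasi-universal spaces. -/
def prod (X : QUS.{u} Ω) (Y : QUS.{v} Ω) : QUS.{max u v} Ω where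
  carrier := X × Y
  plots := {α | Prod.fst ∘ α ∈ X.plots ∧ Prod.snd ∘ α ∈ Y.plots}
  comp_mem _ hα φ hφ := ⟨X.comp_mem _ hα.1 φ hφ, Y.comp_mem _ hα.2 φ hφ⟩
  const_mem x := ⟨X.const_mem x.1, Y.const_mem x.2⟩

/-- The product of a family of quasi-universal spaces. -/
def pi {ι : Type v} (X : ι → QUS.{u} Ω) : QUS.{max u v} Ω where
  carrier := ∀ i, X i
  plots := {α | ∀ i, (fun ω => α ω i) ∈ (X i).plots}
  comp_mem _ hα φ hφ i := (X i).comp_mem _ (hα i) φ hφ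
  const_mem x i := (X i).const_mem (x i)

/-- The finite product `X_{0:n} = X_0 × ⋯ × X_n`. -/
def upTo (X : ℕ → QUS.{u} Ω) (n : ℕ) : QUS.{u} Ω :=
  pi fun i : Finset.Iic n => X i

/-- The projection `∏ X_k → X_{0:n}`. -/
def proj (X : ℕ → QUS.{u} Ω) (n : ℕ) : pi X → upTo X n :=
  fun x i => x i

/-- The projection `X_{0:n+1} → X_{0:n}`. -/
def projSucc (X : ℕ → QUS.{u} Ω) (n : ℕ) : upTo X (n + 1) → upTo X n :=
  fun x i => x ⟨i, Finset.mem_Iic.2 ((Finset.mem_Iic.1 i.2).trans n.le_succ)⟩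

/-- The quasi-universal space `𝓠(X)`: probability measures `μ` on `𝓑(X^Ω)` for which `ω ↦ μ(D_ω)` is
measurable for every `D ∈ 𝓑(Ω^Ω × X^Ω)`, where `D_ω` is the section of `D` at `ω`. -/
def Q (X : QUS.{u} Ω) : QUS.{u} Ω where
  carrier := {μ : Measure X // IsProbabilityMeasure μ ∧
    ∀ D : Set (prod (sample Ω) X), MeasurableSet D →
      Measurable[univMeas Ω] fun ω : Ω => μ {x | (ω, x) ∈ D}}
  plots := {κ | ∀ φ ∈ measurableMaps Ω (univMeas Ω),
    ∀ D : Set (prod (sample Ω) X), MeasurableSet D →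
      Measurable[univMeas Ω] fun ω : Ω => (κ (φ ω)).1 {x | (ω, x) ∈ D}}
  comp_mem _ hκ φ hφ ψ hψ D hD :=
    hκ (φ ∘ ψ) ((sample Ω).comp_mem φ hφ ψ hψ) D hD
  const_mem μ _ _ D hD := μ.2.2 D hD

/-- The quasi-universal space `𝓟(X)` of push-forward probability measures: its points are the measures
`α_* ν` with `α ∈ X^Ω` and `ν ∈ 𝓠(Ω)`, and its plots are the maps `ω ↦ α_* (κ ω)` with `α ∈ X^Ω`
and `κ ∈ 𝓠(Ω)^Ω`. -/
def P (X : QUS.{u} Ω) : QUS.{u} Ω where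
  carrier := {μ : Measure X // ∃ α : sample Ω → X, α ∈ X.plots ∧
    ∃ ν : Q (sample Ω), μ = ν.1.map α}
  plots := {k | ∃ α : sample Ω → X, α ∈ X.plots ∧
    ∃ κ ∈ (Q (sample Ω)).plots, ∀ ω, (k ω).1 = (κ ω).1.map α}
  comp_mem := by
    rintro k ⟨α, hα, κ, hκ, h⟩ φ hφ
    exact ⟨α, hα, κ ∘ φ, (Q (sample Ω)).comp_mem κ hκ φ hφ, fun ω => h (φ ω)⟩
  const_mem := by
    rintro ⟨μ, α, hα, ν, h⟩
    exact ⟨α, hα, fun _ => ν, (Q (sample Ω)).const_mem ν, fun _ => h⟩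

/-- A measurable space is universal if its universal completion is isomorphic to a universally
measurable subset of `ℝ`, with the universally measurable subsets of `ℝ` restricted to it. -/
def IsUniversalMeasurableSpace {X : Type u} (m : MeasurableSpace X) : Prop :=
  ∃ S : Set ℝ, MeasurableSet[univMeas ℝ] S ∧
    Nonempty (@MeasurableEquiv X S (universalCompletion m)
      (MeasurableSpace.comap Subtype.val (univMeas ℝ)))

/-- Universal quasi-universal spaces. -/
def IsUniversal (X : QUS.{u} Ω) : Prop :=
  IsUniversalMeasurableSpace X.sigma ∧ measurableMaps Ω X.sigma = X.plots

/-- Countably separated quasi-universal spaces. -/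
def IsCountablySeparated (X : QUS.{u} Ω) : Prop :=
  MeasurableSpace.CountablySeparated X

/-- `𝓑(Ω^Ω)` is the `σ`-algebra of universally measurable sets. -/
theorem sigma_sample : (sample Ω).sigma = univMeas Ω := by
  ext A
  exact ⟨fun h => h id (@measurable_id _ (univMeas Ω)), fun h _ hα => hα h⟩

/-- Plots are measurable, so the push-forwards in `P` are those of measurable maps. -/
theorem measurable_of_mem_plots {X : QUS.{u} Ω} {α : sample Ω → X} (hα : α ∈ X.plots) :
    Measurable α :=
  fun A hA => by rw [sigma_sample]; exact hA α hα

/-- The projections are quasi-measurable, and so are measurable for the induced `σ`-algebras. -/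
theorem IsQuasiMeasurable.measurable {X : QUS.{u} Ω} {Y : QUS.{v} Ω} {h : X → Y}
    (hh : IsQuasiMeasurable X Y h) : Measurable h :=
  fun _ hA α hα => hA _ (hh α hα)

theorem isQuasiMeasurable_proj (X : ℕ → QUS.{u} Ω) (n : ℕ) :
    IsQuasiMeasurable (pi X) (upTo X n) (proj X n) :=
  fun _ hα i => hα i

theorem isQuasiMeasurable_projSucc (X : ℕ → QUS.{u} Ω) (n : ℕ) :
    IsQuasiMeasurable (upTo X (n + 1)) (upTo X n) (projSucc X n) :=
  fun _ hα i => hα ⟨i, _⟩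

end QUS

/-!
Plots of a quasi-universal space are stable under universally measurable reparametrisations only, so
the argument works with representations `α_* κ(ω)` of measures on the spaces `X_{0:n}`, and
constructs couplings of the sample variables instead of extending measures on the `X_{0:n}`
themselves.

* Universal completions. A probability measure extends uniquely from a `σ`-algebra to its universal
  completion, and universal completion is idempotent. Because `Ω` and `Ω × Ω` are Borel isomorphic,
  `𝓑(Ω^Ω × Ω^Ω)` consists of universally measurable sets. Consequently every probability measure
  lies in `𝓠(Ω)`, and the plots of `𝓠(Ω)` are the universally measurable Markov kernels from `Ω` to
  the Borel space `Ω` (`QUS.qPoint_mem_plots`, `QUS.kernelOfPlot`).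
* Gluing. If two kernels have the same image in a countably generated space `C`, the second can be
  sampled, jointly measurably in the parameter, conditionally on the first so that the images in
  `C` agree almost surely (`exists_gluing_kernel`, from the disintegration of kernels). Iterating
  this with the Ionescu-Tulcea theorem glues a sequence of kernels (`exists_chain_kernel`).
* Existence over `Ω` (`QUS.exists_plot_pi`). Write `Q_n(ω) = α_{n,*} κ_n(ω)` and embed the countably
  separated space `X_{0:n}` measurably into a standard Borel space. Gluing gives a kernel `κ` on
  sequences `(ω_0, ω_1, …)` with `ω_n ∼ κ_n(ω)` and `pr (α_{n+1} ω_{n+1}) = α_n ω_n` almost surely.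
  The map `α` sending such a sequence to the point whose `n`-th coordinate is the last coordinate of
  `α_n ω_n` is a plot of the product, up to a Borel isomorphism of `Ω` with the space of sequences,
  and `α_* κ(ω)` has the images `Q_n(ω)`.
* Uniqueness (`QUS.P_pi_ext`). Two representations of measures with the same finite-dimensional
  images have the same law on a countable product of Cantor spaces; gluing along this law couples
  them so that the represented points coincide almost surely.

Universal spaces are countably separated, so both alternatives of the hypothesis are covered. For a
general `Z`, the limit is defined pointwise, through constant plots; for a plot `ζ` of `Z`
uniqueness identifies its composition with `ζ` with the plot constructed from the `Q_n ∘ ζ`.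
-/

/-! ### Universal completions -/

/-- The set `X` regarded as a measurable space with the universal completion of the `σ`-algebra
of `X`. -/
def UC (X : Type*) : Type _ := X

namespace UC

open ProbabilityTheory

variable {X Y : Type*} [MeasurableSpace X] [MeasurableSpace Y]

instance : MeasurableSpace (UC X) := universalCompletion (X := X) inferInstance

/-- The identity from the universal completion of `X` to `X`. -/
def down (x : UC X) : X := x

/-- The identity from `X` to its universal completion; in general it is not measurable. -/
def up (x : X) : UC X := x

theorem measurableSet_of_base {A : Set X} (hA : MeasurableSet A) :
    MeasurableSet (down ⁻¹' A : Set (UC X)) :=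
  fun _ _ => hA.nullMeasurableSet

theorem measurable_down : Measurable (down : UC X → X) :=
  fun _ hA => measurableSet_of_base hA

theorem nullMeasurableSet {A : Set X} (hA : MeasurableSet (down ⁻¹' A : Set (UC X)))
    (μ : Measure X) [IsProbabilityMeasure μ] : NullMeasurableSet A μ :=
  hA μ inferInstance

theorem isProbabilityMeasure_map_down (ν : Measure (UC X)) [IsProbabilityMeasure ν] :
    IsProbabilityMeasure (ν.map down) :=
  Measure.isProbabilityMeasure_map measurable_down.aemeasurable

/-- A probability measure on a universal completion is determined by its restriction to the original
`σ`-algebra. -/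
theorem map_down_apply (ν : Measure (UC X)) [IsProbabilityMeasure ν] {A : Set X}
    (hA : MeasurableSet (down ⁻¹' A : Set (UC X))) : ν.map down A = ν (down ⁻¹' A) :=
  have := isProbabilityMeasure_map_down ν
  Measure.map_apply₀ measurable_down.aemeasurable (nullMeasurableSet (X := X) hA _)

/-- The extension of a probability measure to the universal completion of its `σ`-algebra: the outer
measure, restricted to the universally measurable sets, which are Carathéodory measurable. -/
noncomputable def extend (μ : Measure X) [IsProbabilityMeasure μ] : Measure (UC X) :=
  OuterMeasure.toMeasure (α := UC X) μ.toOuterMeasure fun A hA => by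
    intro t
    exact (measure_inter_add_sdiff₀ (μ := μ) t (nullMeasurableSet (X := X) hA μ)).symm

theorem extend_apply (μ : Measure X) [IsProbabilityMeasure μ] {A : Set X}
    (hA : MeasurableSet (down ⁻¹' A : Set (UC X))) : extend μ (down ⁻¹' A) = μ A :=
  toMeasure_apply (α := UC X) _ _ hA

instance (μ : Measure X) [IsProbabilityMeasure μ] : IsProbabilityMeasure (extend μ) where
  measure_univ := (extend_apply μ (A := Set.univ) MeasurableSet.univ).trans measure_univ

/-- Null sets of the extension are null sets of the original measure, whether measurable or not. -/
theorem measure_eq_zero_of_extend {μ : Measure X} [IsProbabilityMeasure μ] {N : Set X}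
    (hN : extend μ (down ⁻¹' N) = 0) : μ N = 0 := by
  obtain ⟨M, hNM, hM, hM0⟩ := exists_measurable_superset_of_null (α := UC X) hN
  exact measure_mono_null hNM ((extend_apply μ hM).symm.trans hM0)

/-- Universal completion is idempotent. -/
theorem measurableSet_of_nullMeasurableSet {A : Set (UC X)}
    (hA : ∀ ν : Measure (UC X), IsProbabilityMeasure ν → NullMeasurableSet A ν) :
    MeasurableSet A := by
  intro μ hμ
  obtain ⟨B, hB, hAB⟩ := hA (extend μ) inferInstance
  have hAB' : (A : Set X) =ᵐ[μ] B := measure_eq_zero_of_extend hAB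
  exact (nullMeasurableSet (X := X) hB μ).congr hAB'.symm

theorem measurable_of_aemeasurable {f : UC X → Y}
    (hf : ∀ ν : Measure (UC X), IsProbabilityMeasure ν → AEMeasurable f ν) : Measurable f :=
  fun _ hA => measurableSet_of_nullMeasurableSet fun ν hν =>
    (hf ν hν).nullMeasurable hA

/-- A measurable map on a universal completion stays measurable when its target is universally
completed. -/
theorem measurable_of_measurable_base {f : UC X → Y} (hf : Measurable f) :
    Measurable (β := UC Y) f := fun A hA => by
  refine measurableSet_of_nullMeasurableSet fun ν hν => ?_
  have := Measure.isProbabilityMeasure_map (μ := ν) hf.aemeasurable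
  exact (nullMeasurableSet (X := Y) hA (ν.map f)).preimage (hf.quasiMeasurePreserving ν)

theorem measurable_map {f : X → Y} (hf : Measurable f) :
    Measurable (α := UC X) (β := UC Y) f :=
  measurable_of_measurable_base (hf.comp measurable_down)

/-- Sections of universally measurable sets have universally measurable mass under a
universally measurable kernel: for every `ν`, the set agrees with a measurable set up to a null set
of `ν ⊗ₘ κ`, so the mass of its section agrees `ν`-almost everywhere with a measurable function. -/
theorem measurable_kernel_section (κ : Kernel (UC X) Y) [IsMarkovKernel κ] {D : Set (X × Y)}
    (hD : MeasurableSet (down ⁻¹' D : Set (UC (X × Y)))) :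
    Measurable fun x : UC X => κ x {y | (down x, y) ∈ D} := by
  refine measurable_of_aemeasurable fun ν hν => ?_
  have hm : Measurable (fun p : UC X × Y => (down p.1, p.2)) :=
    (measurable_down.comp measurable_fst).prodMk measurable_snd
  have := Measure.isProbabilityMeasure_map (μ := ν ⊗ₘ κ) hm.aemeasurable
  obtain ⟨E, hE, hDE⟩ := nullMeasurableSet hD ((ν ⊗ₘ κ).map fun p : UC X × Y => (down p.1, p.2))
  have h := Measure.ae_ae_of_ae_compProd (ae_of_ae_map hm.aemeasurable hDE)
  refine ⟨fun x => κ x (Prod.mk x ⁻¹' ((fun p : UC X × Y => (down p.1, p.2)) ⁻¹' E)),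
    Kernel.measurable_kernel_prodMk_left (hm hE), ?_⟩
  filter_upwards [h] with x hx
  exact measure_congr hx

/-- If `g` is measurable for the universal completion, then under the image of a measure by
`ω ↦ (g ω, ω)` almost all points lie on the graph of `g`. -/
theorem ae_map_graph {C : Type*} [MeasurableSpace C] [MeasurableEq C]
    {g : UC X → C} (hg : Measurable g) (ν : Measure (UC X)) [IsProbabilityMeasure ν] :
    ∀ᵐ p ∂(ν.map fun ω => (g ω, down ω)), p.1 = g (up p.2) := by
  have hm : Measurable fun ω : UC X => (g ω, down ω) := hg.prodMk measurable_down
  have := Measure.isProbabilityMeasure_map (μ := ν) hm.aemeasurable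
  have hs : Measurable fun p : UC (C × X) => up (down p).2 :=
    measurable_map (X := C × X) (Y := X) measurable_snd
  have hE : MeasurableSet (down ⁻¹' {p : C × X | p.1 = g (up p.2)}) :=
    measurableSet_eq_fun (α := UC (C × X)) (measurable_fst.comp measurable_down)
      (hg.comp hs)
  have hE' : MeasurableSet (down ⁻¹' {p : C × X | p.1 = g (up p.2)}ᶜ) := hE.compl
  refine (Measure.map_apply₀ hm.aemeasurable (nullMeasurableSet (X := C × X) hE' _)).trans ?_
  convert measure_empty (μ := ν)
  ext ω
  simp [down, up]

end UC

/-! ### Gluing of kernels -/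

section Gluing

open ProbabilityTheory

variable {T S S' C : Type*} [MeasurableSpace T] [MeasurableSpace S] [MeasurableSpace S']
  [MeasurableSpace C]

/-- If the images of `η t` under `a` and of `η' t` under `b` agree for all `t`, then `η'` can be
sampled after `η` by a kernel under which `a s = b s'` almost surely: the conditional law of `s'`
given `b s'`, evaluated at `a s`. -/
theorem exists_gluing_kernel [MeasurableSpace.CountablyGenerated C] [MeasurableEq C]
    [StandardBorelSpace S'] [Nonempty S']
    (η : Kernel T S) (η' : Kernel T S') [IsMarkovKernel η] [IsMarkovKernel η']
    {a : S → C} {b : S' → C} (ha : Measurable a) (hb : Measurable b)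
    (hab : ∀ t, (η t).map a = (η' t).map b) :
    ∃ K : Kernel (T × S) S', IsMarkovKernel K ∧
      (∀ t, (K.comap (Prod.mk t) measurable_prodMk_left) ∘ₘ (η t) = η' t) ∧
      ∀ t, ∀ᵐ s ∂η t, ∀ᵐ s' ∂K (t, s), a s = b s' := by
  have hm : Measurable fun s' => (b s', s') := hb.prodMk measurable_id
  let ρ : Kernel T (C × S') := η'.map fun s' => (b s', s')
  have hρM : IsMarkovKernel ρ := Kernel.IsMarkovKernel.map _ hm
  let k := ρ.condKernel
  have hρ : ∀ t, ρ t = ((η t).map a) ⊗ₘ (k.comap (Prod.mk t) measurable_prodMk_left) := by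
    intro t
    have h1 : ρ.fst t = (η t).map a := by
      rw [hab, Kernel.fst_apply, Kernel.map_apply _ hm, Measure.map_map measurable_fst hm]
      rfl
    rw [← h1]
    conv_lhs => rw [← ρ.disintegrate ρ.condKernel]
    rw [Kernel.compProd_apply_eq_compProd_sectR]
    rfl
  have hat : Measurable (fun p : T × S => (p.1, a p.2)) :=
    measurable_fst.prodMk (ha.comp measurable_snd)
  refine ⟨k.comap (fun p => (p.1, a p.2)) hat, inferInstance, fun t => ?_, fun t => ?_⟩
  · have h2 : (ρ t).snd = η' t := by
      rw [Kernel.map_apply _ hm, Measure.snd, Measure.map_map measurable_snd hm]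
      exact Measure.map_id
    have := Measure.isProbabilityMeasure_map (μ := η t) ha.aemeasurable
    rw [← h2, hρ, Measure.snd_compProd, ← Measure.deterministic_comp_eq_map ha, Measure.comp_assoc]
    congr 1
    ext s : 1
    rw [Kernel.comp_deterministic_eq_comap]
    rfl
  · have h3 : ∀ᵐ p ∂ρ t, p.1 = b p.2 := by
      rw [Kernel.map_apply _ hm]
      exact (ae_map_iff hm.aemeasurable
        (measurableSet_eq_fun measurable_fst (hb.comp measurable_snd))).2
          (Filter.Eventually.of_forall fun _ => rfl)
    have := Measure.isProbabilityMeasure_map (μ := η t) ha.aemeasurable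
    rw [hρ] at h3
    exact ae_of_ae_map ha.aemeasurable (Measure.ae_ae_of_ae_compProd h3)

open Preorder in
/-- A sequence of kernels whose images match as in `exists_gluing_kernel` is the sequence of
marginals of a Markov chain along which `a (x n) = b (x (n + 1))` almost surely. -/
theorem exists_chain_kernel [MeasurableSpace.CountablyGenerated C] [MeasurableEq C]
    [StandardBorelSpace S] [Nonempty S]
    (η : ℕ → Kernel T S) [∀ n, IsMarkovKernel (η n)]
    {a b : S → C} (ha : Measurable a) (hb : Measurable b)
    (hab : ∀ n t, (η n t).map a = (η (n + 1) t).map b) :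
    ∃ K : Kernel T (ℕ → S), IsMarkovKernel K ∧
      (∀ n t, (K t).map (fun x => x n) = η n t) ∧
      ∀ n t, ∀ᵐ x ∂K t, a (x n) = b (x (n + 1)) := by
  choose k hkM hk hkae using fun n => exists_gluing_kernel (η n) (η (n + 1)) ha hb (hab n)
  -- The Ionescu-Tulcea theorem has no parameter space; the parameter is carried along in the state.
  let st (n : ℕ) : Kernel (T × S) (T × S) := Kernel.deterministic Prod.fst measurable_fst ×ₖ k n
  have hst : ∀ n t s, st n (t, s) = (k n (t, s)).map (Prod.mk t) := by
    intro n t s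
    rw [Kernel.prod_apply, Kernel.deterministic_apply, Measure.dirac_prod]
  let κ (n : ℕ) : Kernel (Π _ : Finset.Iic n, T × S) (T × S) :=
    (st n).comap (fun x => x ⟨n, Finset.mem_Iic.2 le_rfl⟩) (measurable_pi_apply _)
  let start : Kernel T (Π _ : Finset.Iic 0, T × S) :=
    (Kernel.id ×ₖ η 0).map (fun p _ => p)
  let L : Kernel T (ℕ → T × S) := Kernel.traj (X := fun _ => T × S) κ 0 ∘ₖ start
  have hstart : IsMarkovKernel start := Kernel.IsMarkovKernel.map _ (by fun_prop)
  have hLM : IsMarkovKernel L := by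
    change IsMarkovKernel (_ ∘ₖ _)
    infer_instance
  let ev (n : ℕ) (y : Π _ : Finset.Iic n, T × S) : T × S := y ⟨n, Finset.mem_Iic.2 le_rfl⟩
  have hev : ∀ n, Measurable (ev n) := fun n => measurable_pi_apply _
  let Ln (n : ℕ) : Kernel T (Π _ : Finset.Iic n, T × S) :=
    Kernel.partialTraj (X := fun _ => T × S) κ 0 n ∘ₖ start
  have hL : ∀ n t, L t = Kernel.traj (X := fun _ => T × S) κ n ∘ₘ Ln n t := by
    intro n t
    rw [← Kernel.comp_apply, ← Kernel.comp_assoc, Kernel.traj_comp_partialTraj (Nat.zero_le n)]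
  have hLn : ∀ n t, (L t).map (fun x => x n) = (Ln n t).map (ev n) := by
    intro n t
    have h : Ln n = L.map (frestrictLe n) := by
      rw [Kernel.map_comp, Kernel.traj_map_frestrictLe]
    rw [h, Kernel.map_apply _ (by fun_prop), Measure.map_map (hev n) (by fun_prop)]
    rfl
  have htraj : ∀ n y, (Kernel.traj (X := fun _ => T × S) κ n y).map (fun x => (x n, x (n + 1)))
      = ((Kernel.id ×ₖ st n).comap (ev n) (hev n)) y := by
    intro n y
    rw [Kernel.comap_apply, Kernel.prod_apply, Kernel.id_apply, Measure.dirac_prod,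
      ← Kernel.traj_map_updateFinset, Measure.map_map (by fun_prop) (by fun_prop)]
    have h : (Kernel.traj (X := fun _ => T × S) κ n y).map (fun x => x (n + 1)) =
        st n (ev n y) := by
      rw [← Kernel.map_apply _ (by fun_prop), Kernel.map_traj_succ_self]
      rfl
    rw [← h, Measure.map_map measurable_prodMk_left (by fun_prop)]
    congr 1
    ext x : 1
    simp [Function.updateFinset, ev]
  -- The joint law of two consecutive states.
  have hJ : ∀ n t, (L t).map (fun x => (x n, x (n + 1))) = ((L t).map fun x => x n) ⊗ₘ st n := by
    intro n t
    rw [Measure.compProd_eq_comp_prod, hLn, ← Measure.deterministic_comp_eq_map (hev n),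
      Measure.comp_assoc, Kernel.comp_deterministic_eq_comap, hL n,
      Measure.map_comp _ _ (by fun_prop)]
    congr 1
    ext y : 1
    rw [Kernel.map_apply _ (by fun_prop), htraj]
  have hM : ∀ n t, (L t).map (fun x => x n) = (η n t).map (Prod.mk t) := by
    intro n t
    induction n with
    | zero =>
      have h : Ln 0 = start := by
        simp only [Ln, Kernel.partialTraj_self, Kernel.id_comp]
      rw [hLn, h, Kernel.map_apply _ (by fun_prop), Measure.map_map (hev 0) (by fun_prop),
        Kernel.prod_apply, Kernel.id_apply, Measure.dirac_prod]
      exact Measure.map_id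
    | succ n ih =>
      have h := congrArg Measure.snd (hJ n t)
      rw [Measure.snd_compProd, Measure.snd, Measure.map_map measurable_snd (by fun_prop), ih,
        ← Measure.deterministic_comp_eq_map measurable_prodMk_left, Measure.comp_assoc,
        Kernel.comp_deterministic_eq_comap] at h
      refine h.trans ?_
      rw [← hk n t, Measure.map_comp _ _ measurable_prodMk_left]
      congr 1
      ext s : 1
      rw [Kernel.map_apply _ measurable_prodMk_left]
      exact hst n t s
  refine ⟨L.map fun x n => (x n).2, Kernel.IsMarkovKernel.map _ (by fun_prop), fun n t => ?_,
    fun n t => ?_⟩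
  · have h := congrArg (Measure.map Prod.snd) (hM n t)
    rw [Measure.map_map measurable_snd (by fun_prop),
      Measure.map_map measurable_snd measurable_prodMk_left] at h
    rw [Kernel.map_apply _ (by fun_prop), Measure.map_map (by fun_prop) (by fun_prop)]
    exact h.trans Measure.map_id
  · have hE : MeasurableSet {p : (T × S) × (T × S) | a p.1.2 = b p.2.2} :=
      measurableSet_eq_fun (by fun_prop) (by fun_prop)
    rw [Kernel.map_apply _ (by fun_prop)]
    refine (ae_map_iff (Measurable.aemeasurable (by fun_prop))
      (measurableSet_eq_fun (by fun_prop) (by fun_prop))).2 ?_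
    refine ae_of_ae_map (f := fun x : ℕ → T × S => (x n, x (n + 1)))
      (p := fun p => a p.1.2 = b p.2.2) (by fun_prop) ?_
    rw [hJ, hM, Measure.ae_compProd_iff hE]
    refine (ae_map_iff measurable_prodMk_left.aemeasurable
      (Kernel.measurable_kernel_prodMk_left (κ := st n) hE.compl (measurableSet_singleton 0))).2 ?_
    filter_upwards [hkae n t] with s hs
    have h : ∀ᵐ s' ∂(k n (t, s)).map (Prod.mk t), a s = b s'.2 :=
      (ae_map_iff measurable_prodMk_left.aemeasurable
        (measurableSet_eq_fun (by fun_prop) (by fun_prop))).2 hs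
    rw [← hst] at h
    exact h

end Gluing

/-! ### Measures on countable products -/

open Preorder in
/-- Finite measures on a countable product are determined by their images in the initial finite
products. -/
theorem measure_pi_nat_ext {X : ℕ → Type*} [∀ n, MeasurableSpace (X n)]
    {μ ν : Measure (∀ n, X n)} [IsFiniteMeasure μ]
    (h : ∀ n, μ.map (frestrictLe n) = ν.map (frestrictLe n)) : μ = ν := by
  have hν : IsProjectiveLimit ν fun I => μ.map I.restrict := by
    intro I
    have hI : I ⊆ Finset.Iic (I.sup id) := I.subset_Iic_sup_id
    have hr : (I.restrict : (∀ n, X n) → _) = Finset.restrict₂ hI ∘ frestrictLe (I.sup id) := rfl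
    rw [hr, ← Measure.map_map (by fun_prop) (by fun_prop), ← h,
      Measure.map_map (by fun_prop) (by fun_prop)]
    rfl
  exact IsProjectiveLimit.unique (P := fun I => μ.map I.restrict) (fun I => rfl) hν

/-! ### Universal spaces are countably separated -/

namespace QUS

open ProbabilityTheory

variable {Ω : Type w} [TopologicalSpace Ω]

/-- The induced `σ`-algebra of a quasi-universal space is universally complete, because plots are
measurable and the sample space is universally complete. -/
theorem universalCompletion_sigma_le (X : QUS.{u} Ω) : universalCompletion X.sigma ≤ X.sigma := by
  borelize Ω
  intro A hA α hα
  have h : Measurable (α := UC Ω) (β := X) α := fun _ hB => hB α hα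
  exact UC.measurable_of_measurable_base h hA

theorem IsUniversal.isCountablySeparated {X : QUS.{u} Ω} (hX : X.IsUniversal) :
    X.IsCountablySeparated := by
  obtain ⟨⟨S, -, ⟨e⟩⟩, -⟩ := hX
  have he : Measurable[universalCompletion X.sigma,
      MeasurableSpace.comap Subtype.val (univMeas ℝ)] e :=
    @MeasurableEquiv.measurable X S (universalCompletion X.sigma)
      (MeasurableSpace.comap Subtype.val (univMeas ℝ)) e
  have hf : Measurable (fun x : X => ((e x : S) : ℝ)) := by
    intro B hB
    refine universalCompletion_sigma_le X _ ?_
    refine he ⟨B, ?_, rfl⟩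
    intro μ _
    rw [BorelSpace.measurable_eq (α := ℝ)] at hB
    exact hB.nullMeasurableSet
  have hinj : Function.Injective (fun x : X => ((e x : S) : ℝ)) :=
    Subtype.val_injective.comp
      (@MeasurableEquiv.injective X S (universalCompletion X.sigma)
      (MeasurableSpace.comap Subtype.val (univMeas ℝ)) e)
  refine @MeasurableSpace.CountablySeparated.mono X
    (MeasurableSpace.comap (fun x : X => ((e x : S) : ℝ)) inferInstance) _ ?_ hf.comap_le
  let := MeasurableSpace.comap (fun x : X => ((e x : S) : ℝ)) inferInstance
  have : MeasurableSpace.CountablyGenerated X := .comap _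
  have : MeasurableSpace.SeparatesPoints X := by
    refine ⟨fun x y h => hinj ?_⟩
    have := h _ ⟨{((e x : S) : ℝ)}, measurableSet_singleton _, rfl⟩ rfl
    exact (Set.mem_singleton_iff.1 this).symm
  infer_instance

/-! ### The sample space and its probability measures -/

section Sample

variable [MeasurableSpace Ω] [BorelSpace Ω]

theorem univMeas_eq : univMeas Ω = (inferInstance : MeasurableSpace (UC Ω)) := by
  rw [univMeas, ← BorelSpace.measurable_eq]; rfl

/-- The identity, as an isomorphism: the sample space is the universal completion of the
Borel space `Ω`. -/
def toSample : UC Ω ≃ᵐ sample Ω where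
  toFun ω := ω
  invFun ω := ω
  left_inv _ := rfl
  right_inv _ := rfl
  measurable_toFun A hA := by
    rw [sigma_sample, univMeas_eq] at hA
    exact hA
  measurable_invFun A hA := by
    rw [sigma_sample, univMeas_eq]
    exact hA

theorem measurable_plot {X : QUS.{u} Ω} {α : sample Ω → X} (hα : α ∈ X.plots) :
    Measurable (α ∘ toSample) :=
  (measurable_of_mem_plots hα).comp toSample.measurable

theorem measurableSet_univMeas {A : Set Ω} :
    MeasurableSet[univMeas Ω] A ↔ MeasurableSet (UC.down ⁻¹' A : Set (UC Ω)) := by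
  rw [univMeas_eq]
  rfl

theorem measurable_univMeas {Y : Type*} [MeasurableSpace Y] {f : Ω → Y} :
    Measurable[univMeas Ω] f ↔ Measurable fun ω : UC Ω => f ω.down := by
  rw [univMeas_eq]
  rfl

theorem mem_measurableMaps {φ : Ω → Ω} :
    φ ∈ measurableMaps Ω (univMeas Ω) ↔ Measurable fun ω : UC Ω => UC.up (φ ω.down) := by
  rw [measurableMaps, univMeas_eq]
  rfl

theorem mem_measurableMaps_of_measurable {φ : Ω → Ω} (hφ : Measurable φ) :
    φ ∈ measurableMaps Ω (univMeas Ω) :=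
  mem_measurableMaps.2 (UC.measurable_map (X := Ω) (Y := Ω) hφ)

/-- Since `Ω` and `Ω × Ω` are Borel isomorphic, the sets of `𝓑(Ω^Ω × Ω^Ω)` are universally
measurable subsets of `Ω × Ω`. -/
theorem measurableSet_of_prod_sample [PolishSpace Ω] [Uncountable Ω]
    {D : Set (prod (sample Ω) (sample Ω))} (hD : MeasurableSet D) :
    MeasurableSet (UC.down ⁻¹' (D : Set (Ω × Ω)) : Set (UC (Ω × Ω))) := by
  have hΩ : ¬ Countable Ω := not_countable_iff.2 ‹_›
  have e : Ω ≃ᵐ Ω × Ω := PolishSpace.measurableEquivOfNotCountable hΩ fun h =>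
    hΩ (Function.Injective.countable (f := fun ω : Ω => (ω, ω)) fun _ _ h => congrArg Prod.fst h)
  have key (E : Set (Ω × Ω)) (hE : MeasurableSet[univMeas Ω] (e ⁻¹' E)) :
      MeasurableSet (UC.down ⁻¹' E : Set (UC (Ω × Ω))) := by
    have h := UC.measurable_map (X := Ω × Ω) (Y := Ω) e.symm.measurable
      (measurableSet_univMeas.1 hE)
    rwa [← Set.preimage_id (s := E), ← e.self_comp_symm]
  exact key D <| hD e
    ⟨mem_measurableMaps_of_measurable (measurable_fst.comp e.measurable),
    mem_measurableMaps_of_measurable (measurable_snd.comp e.measurable)⟩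

/-- The extension of a Borel probability measure to the sample space. -/
noncomputable def extendSample (μ : Measure Ω) [IsProbabilityMeasure μ] : Measure (sample Ω) :=
  (UC.extend μ).map toSample

theorem extendSample_apply (μ : Measure Ω) [IsProbabilityMeasure μ] {A : Set Ω}
    (hA : MeasurableSet (UC.down ⁻¹' A : Set (UC Ω))) :
    extendSample μ (A : Set (sample Ω)) = μ A :=
  (MeasurableEquiv.map_apply toSample (μ := UC.extend μ) (A : Set (sample Ω))).trans
    (UC.extend_apply μ hA)

instance (μ : Measure Ω) [IsProbabilityMeasure μ] : IsProbabilityMeasure (extendSample μ) :=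
  Measure.isProbabilityMeasure_map toSample.measurable.aemeasurable

theorem measurable_extendSample_section [PolishSpace Ω] [Uncountable Ω]
    (κ : Kernel (UC Ω) Ω) [IsMarkovKernel κ] {D : Set (prod (sample Ω) (sample Ω))}
    (hD : MeasurableSet D) :
    Measurable[univMeas Ω] fun ω : Ω => extendSample (κ (UC.up ω)) {x | (ω, x) ∈ D} := by
  have hD' := measurableSet_of_prod_sample hD
  have h := UC.measurable_kernel_section κ hD'
  refine measurable_univMeas.2 ?_
  convert! h using 2 with ω
  exact extendSample_apply _
    (UC.measurable_map (X := Ω) (Y := Ω × Ω) (measurable_prodMk_left (x := UC.down ω)) hD')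

/-- The point of `𝓠(Ω)` given by a Borel probability measure; every such measure qualifies. -/
noncomputable def qPoint [PolishSpace Ω] [Uncountable Ω] (μ : Measure Ω)
    [IsProbabilityMeasure μ] : Q (sample Ω) :=
  ⟨extendSample μ, inferInstance, fun _ hD =>
    measurable_extendSample_section (Kernel.const (UC Ω) μ) hD⟩

theorem qPoint_mem_plots [PolishSpace Ω] [Uncountable Ω] (κ : Kernel (UC Ω) Ω) [IsMarkovKernel κ] :
    (fun ω : Ω => qPoint (κ (UC.up ω))) ∈ (Q (sample Ω)).plots :=
  fun _ hφ _ hD =>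
    measurable_extendSample_section (κ.comap _ (mem_measurableMaps.1 hφ)) hD

/-- A plot of `𝓠(Ω)` as a kernel on the universal completion of `Ω`. -/
noncomputable def kernelOfPlot {κ : Ω → Q (sample Ω)} (hκ : κ ∈ (Q (sample Ω)).plots) :
    Kernel (UC Ω) (UC Ω) where
  toFun ω := (κ ω.down).1.map toSample.symm
  measurable' := by
    refine Measure.measurable_of_measurable_coe _ fun A hA => ?_
    have hA' : MeasurableSet (toSample.symm ⁻¹' A : Set (sample Ω)) :=
      toSample.symm.measurable hA
    have h := measurable_univMeas.1 <| hκ id (mem_measurableMaps_of_measurable measurable_id)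
      {p | p.2 ∈ (toSample.symm ⁻¹' A : Set (sample Ω))} fun α hα => hA' _ hα.2
    convert! h using 2 with ω
    exact MeasurableEquiv.map_apply _ _

instance {κ : Ω → Q (sample Ω)} (hκ : κ ∈ (Q (sample Ω)).plots) :
    IsMarkovKernel (kernelOfPlot hκ) where
  isProbabilityMeasure ω :=
    have := (κ ω.down).2.1
    Measure.isProbabilityMeasure_map toSample.symm.measurable.aemeasurable

theorem kernelOfPlot_map {κ : Ω → Q (sample Ω)} (hκ : κ ∈ (Q (sample Ω)).plots) {X : QUS.{u} Ω}
    {α : sample Ω → X} (hα : α ∈ X.plots) (ω : Ω) :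
    (kernelOfPlot hκ (UC.up ω)).map (α ∘ toSample) = (κ ω).1.map α := by
  change ((κ ω).1.map toSample.symm).map _ = _
  rw [Measure.map_map (measurable_plot hα) toSample.symm.measurable]
  rfl

theorem exists_kernel_of_plot {X : QUS.{u} Ω} {q : Ω → P X} (hq : q ∈ (P X).plots) :
    ∃ α : sample Ω → X, α ∈ X.plots ∧ ∃ K : Kernel (UC Ω) (UC Ω), IsMarkovKernel K ∧
      ∀ ω : UC Ω, (q ω.down).1 = (K ω).map (α ∘ toSample) := by
  obtain ⟨α, hα, κ, hκ, h⟩ := hq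
  exact ⟨α, hα, kernelOfPlot hκ, inferInstance, fun ω =>
    (h ω.down).trans (kernelOfPlot_map hκ hα ω.down).symm⟩

/-- A plot `α` and a kernel with Borel target define a plot of `𝓟(X)`; the masses of its values are
given by outer measures, as `{ω' | α ω' ∈ A}` is universally measurable but need not be Borel. -/
theorem exists_plot_of_kernel [PolishSpace Ω] [Uncountable Ω] {X : QUS.{u} Ω} {α : sample Ω → X}
    (hα : α ∈ X.plots) (K : Kernel (UC Ω) Ω) [IsMarkovKernel K] :
    ∃ k ∈ (P X).plots, ∀ (ω : Ω) (A : Set X), MeasurableSet A →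
      (k ω).1 A = K (UC.up ω) {ω' | α ω' ∈ A} := by
  refine ⟨fun ω => ⟨_, α, hα, qPoint (K (UC.up ω)), rfl⟩,
    ⟨α, hα, _, qPoint_mem_plots K, fun _ => rfl⟩, fun ω A hA => ?_⟩
  refine (Measure.map_apply (measurable_of_mem_plots hα) hA).trans ?_
  exact extendSample_apply _ (measurable_plot hα hA)

/-! ### Uniqueness of the projective limit -/

theorem exists_eq_map {X : QUS.{u} Ω} (p : P X) :
    ∃ α : sample Ω → X, α ∈ X.plots ∧ ∃ ν : Measure (UC Ω), IsProbabilityMeasure ν ∧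
      p.1 = ν.map (α ∘ toSample) := by
  obtain ⟨α, hα, K, hK, h⟩ := exists_kernel_of_plot ((P X).const_mem p)
  obtain ⟨-, -, ν, -⟩ := p.2
  have := ν.2.1
  have ω : UC Ω := (nonempty_of_isProbabilityMeasure ν.1).some
  exact ⟨α, hα, K ω, inferInstance, h ω⟩

/-- If the `X n` are countably separated, a point of `𝓟(∏ X n)` is determined by its images in
`𝓟(X_{0:n})`. Two representations `α_* ν` and `α'_* ν'` with the same finite-dimensional images
have the same law on the countable product of Cantor spaces; gluing `ν` and `ν'` along it gives a
coupling under which `α ω = α' ω'` almost surely. -/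
theorem P_pi_ext [PolishSpace Ω] {X : ℕ → QUS.{u} Ω} (hX : ∀ n, (X n).IsCountablySeparated)
    {p p' : P (pi X)} (h : ∀ n, p.1.map (proj X n) = p'.1.map (proj X n)) : p = p' := by
  have hX' (n : ℕ) : MeasurableSpace.CountablySeparated (X n) := hX n
  choose f hf hfi using fun n =>
    MeasurableSpace.measurable_injection_nat_bool_of_countablySeparated (X n)
  have hpi (k : ℕ) : Measurable fun x : pi X => x k :=
    IsQuasiMeasurable.measurable (X := pi X) (Y := X k) fun _ hα => hα k
  have hup (n : ℕ) (k : Finset.Iic n) : Measurable fun x : upTo X n => x k :=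
    IsQuasiMeasurable.measurable (X := upTo X n) (Y := X k) fun _ hα => hα k
  have hproj (n : ℕ) := (isQuasiMeasurable_proj X n).measurable
  let F : pi X → ℕ → ℕ → Bool := fun x k => f k (x k)
  have hF : Measurable F := measurable_pi_lambda _ fun k => (hf k).comp (hpi k)
  have hFi : Function.Injective F := fun x y hxy =>
    funext fun k => hfi k (congrFun hxy k)
  obtain ⟨α, hα, ν, hν, hp⟩ := exists_eq_map p
  obtain ⟨α', hα', ν', hν', hp'⟩ := exists_eq_map p'
  have hαm := measurable_plot hα
  have hαm' := measurable_plot hα'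
  have hpP : IsProbabilityMeasure p.1 := by
    rw [hp]
    exact Measure.isProbabilityMeasure_map hαm.aemeasurable
  have hlaw : p.1.map F = p'.1.map F := by
    have := Measure.isProbabilityMeasure_map (μ := p.1) hF.aemeasurable
    refine measure_pi_nat_ext fun n => ?_
    let Fn : upTo X n → (Finset.Iic n → ℕ → Bool) := fun x k => f k (x k)
    have hFn : Measurable Fn := measurable_pi_lambda _ fun k => (hf k).comp (hup n k)
    have hFF : Preorder.frestrictLe n ∘ F = Fn ∘ proj X n := rfl
    rw [Measure.map_map (by fun_prop) hF, Measure.map_map (by fun_prop) hF, hFF,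
      ← Measure.map_map hFn (hproj n), ← Measure.map_map hFn (hproj n), h]
  let g : UC Ω → ℕ → ℕ → Bool := F ∘ α ∘ toSample
  let g' : UC Ω → ℕ → ℕ → Bool := F ∘ α' ∘ toSample
  have hg : Measurable g := hF.comp hαm
  have hg' : Measurable g' := hF.comp hαm'
  have hm : Measurable fun ω => (g ω, UC.down ω) := hg.prodMk UC.measurable_down
  have hm' : Measurable fun ω => (g' ω, UC.down ω) := hg'.prodMk UC.measurable_down
  let μ := ν.map fun ω => (g ω, UC.down ω)
  let μ' := ν'.map fun ω => (g' ω, UC.down ω)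
  have hμ : IsProbabilityMeasure μ := Measure.isProbabilityMeasure_map hm.aemeasurable
  have hμ' : IsProbabilityMeasure μ' := Measure.isProbabilityMeasure_map hm'.aemeasurable
  have hΩ : Nonempty Ω := (nonempty_of_isProbabilityMeasure μ).map Prod.snd
  obtain ⟨K, hK, hKμ, hKae⟩ := exists_gluing_kernel (Kernel.const Unit μ) (Kernel.const Unit μ')
    (measurable_fst (α := ℕ → ℕ → Bool) (β := Ω)) (measurable_fst (α := ℕ → ℕ → Bool) (β := Ω))
    (by
      intro _
      rw [Kernel.const_apply, Kernel.const_apply, Measure.map_map measurable_fst hm,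
        Measure.map_map measurable_fst hm']
      rw [hp, hp', Measure.map_map hF hαm, Measure.map_map hF hαm'] at hlaw
      exact hlaw)
  let k := K.comap (Prod.mk ()) measurable_prodMk_left
  have hfst : (μ ⊗ₘ k).map Prod.fst = μ := Measure.fst_compProd _ _
  have hsnd : (μ ⊗ₘ k).map Prod.snd = μ' := (Measure.snd_compProd _ _).trans (hKμ ())
  have hae : ∀ᵐ q ∂(μ ⊗ₘ k), q.1.1 = q.2.1 :=
    (Measure.ae_compProd_iff (measurableSet_eq_fun (by fun_prop) (by fun_prop))).2 (hKae ())
  have hgr : ∀ᵐ q ∂(μ ⊗ₘ k), q.1.1 = g (UC.up q.1.2) :=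
    ae_of_ae_map (p := fun s : (ℕ → ℕ → Bool) × Ω => s.1 = g (UC.up s.2))
      measurable_fst.aemeasurable (by
      rw [hfst]
      exact UC.ae_map_graph hg ν)
  have hgr' : ∀ᵐ q ∂(μ ⊗ₘ k), q.2.1 = g' (UC.up q.2.2) :=
    ae_of_ae_map (p := fun s : (ℕ → ℕ → Bool) × Ω => s.1 = g' (UC.up s.2))
      measurable_snd.aemeasurable (by
      rw [hsnd]
      exact UC.ae_map_graph hg' ν')
  -- `A` need not have a measurable preimage in the coupling space; it is null measurable, and its
  -- mass is that under the marginal.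
  have key (β : sample Ω → pi X) (hβ : β ∈ (pi X).plots) (ρ : Measure (UC Ω))
      (hρ : IsProbabilityMeasure ρ) (r : ((ℕ → ℕ → Bool) × Ω) × ((ℕ → ℕ → Bool) × Ω) → Ω)
      (hr : Measurable r) (hrρ : (μ ⊗ₘ k).map r = ρ.map UC.down)
      (A : Set (pi X)) (hA : MeasurableSet A) :
      ρ.map (β ∘ toSample) A = (μ ⊗ₘ k) {q | β (toSample (UC.up (r q))) ∈ A} := by
    have hB : MeasurableSet (UC.down ⁻¹' {ω : Ω | β (toSample (UC.up ω)) ∈ A}) :=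
      measurable_plot hβ hA
    have := UC.isProbabilityMeasure_map_down ρ
    rw [Measure.map_apply (measurable_plot hβ) hA]
    refine (UC.map_down_apply ρ hB).symm.trans ?_
    have hn := UC.nullMeasurableSet hB (ρ.map UC.down)
    rw [← hrρ] at hn ⊢
    exact Measure.map_apply₀ hr.aemeasurable hn
  refine Subtype.ext (Measure.ext fun A hA => ?_)
  rw [hp, hp', key α hα ν hν (fun q => q.1.2) (by fun_prop) ?_ A hA,
    key α' hα' ν' hν' (fun q => q.2.2) (by fun_prop) ?_ A hA]
  · refine measure_congr ?_
    filter_upwards [hae, hgr, hgr'] with q h1 h2 h3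
    have h4 : α (toSample (UC.up q.1.2)) = α' (toSample (UC.up q.2.2)) :=
      hFi (h2.symm.trans (h1.trans h3))
    change (_ ∈ A) = (_ ∈ A)
    rw [h4]
  · change (μ ⊗ₘ k).map (Prod.snd ∘ Prod.snd) = _
    rw [← Measure.map_map measurable_snd measurable_snd, hsnd,
      Measure.map_map measurable_snd hm']
    rfl
  · change (μ ⊗ₘ k).map (Prod.snd ∘ Prod.fst) = _
    rw [← Measure.map_map measurable_snd measurable_fst, hfst,
      Measure.map_map measurable_snd hm]
    rfl

/-! ### Existence of the projective limit -/

/-- Existence of the projective limit over the sample space. The state of the chain consists of the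
sample variable `ω_n`, the code of `α n ω_n` and the code of its projection one level down. The
codes are part of the state because as functions of `ω_n` they are only universally measurable, while
the gluing of kernels needs Borel maps. -/
theorem exists_plot_pi [PolishSpace Ω] [Uncountable Ω] {X : ℕ → QUS.{u} Ω}
    (hX : ∀ n, (X n).IsCountablySeparated) (q : ∀ n, Ω → P (upTo X n))
    (hq : ∀ n, q n ∈ (P (upTo X n)).plots)
    (hqs : ∀ n ω, (q (n + 1) ω).1.map (projSucc X n) = (q n ω).1) :
    ∃ k ∈ (P (pi X)).plots, ∀ n ω, (k ω).1.map (proj X n) = (q n ω).1 := by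
  have hf (n : ℕ) : ∃ f : upTo X n → ℕ → ℕ → Bool, Measurable f ∧ Function.Injective f := by
    have hX' (n : ℕ) : MeasurableSpace.CountablySeparated (X n) := hX n
    choose f hf hfi using fun n =>
      MeasurableSpace.measurable_injection_nat_bool_of_countablySeparated (X n)
    have hup (k : Finset.Iic n) : Measurable fun x : upTo X n => x k :=
      IsQuasiMeasurable.measurable (X := upTo X n) (Y := X k) fun _ hα => hα k
    refine ⟨fun x k => if h : k ∈ Finset.Iic n then f k (x ⟨k, h⟩) else fun _ => false,
      measurable_pi_lambda _ fun k => ?_, fun x y hxy => funext fun k => hfi k ?_⟩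
    · by_cases h : k ∈ Finset.Iic n
      · simp only [h, dif_pos]
        exact (hf k).comp (hup ⟨k, h⟩)
      · simp only [h, dif_neg, not_false_eq_true]
        exact measurable_const
    · simpa [k.2] using congrFun hxy k
  choose f hf hfi using hf
  choose α hα K hK hqK using fun n => exists_kernel_of_plot (hq n)
  have hαm (n : ℕ) := measurable_plot (hα n)
  have hproj (n : ℕ) := (isQuasiMeasurable_proj X n).measurable
  have hps (n : ℕ) := (isQuasiMeasurable_projSucc X n).measurable
  -- `g n` codes the point at level `n`, `h n` its projection one level down. There is no level
  -- below `0`, and the value of `h 0` does not matter.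
  let g (n : ℕ) : UC Ω → ℕ → ℕ → Bool := f n ∘ α n ∘ toSample
  let h (n : ℕ) : UC Ω → ℕ → ℕ → Bool :=
    n.casesOn (g 0) fun n => f n ∘ projSucc X n ∘ α (n + 1) ∘ toSample
  have hg (n : ℕ) : Measurable (g n) := (hf n).comp (hαm n)
  have hh (n : ℕ) : Measurable (h n) := by
    cases n with
    | zero => exact hg 0
    | succ n => exact (hf n).comp ((hps n).comp (hαm (n + 1)))
  have hm (n : ℕ) : Measurable fun ω => ((g n ω, h n ω), UC.down ω) :=
    ((hg n).prodMk (hh n)).prodMk UC.measurable_down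
  let η (n : ℕ) : Kernel (UC Ω) (((ℕ → ℕ → Bool) × (ℕ → ℕ → Bool)) × Ω) :=
    (K n).map fun ω => ((g n ω, h n ω), UC.down ω)
  have hη (n : ℕ) (ω : UC Ω) : η n ω = (K n ω).map fun ω => ((g n ω, h n ω), UC.down ω) :=
    Kernel.map_apply _ (hm n) ω
  have hηM (n : ℕ) : IsMarkovKernel (η n) := Kernel.IsMarkovKernel.map _ (hm n)
  have hab (n : ℕ) (ω : UC Ω) :
      (η n ω).map (fun s => s.1.1) = (η (n + 1) ω).map (fun s => s.1.2) := by
    rw [hη, hη, Measure.map_map (by fun_prop) (hm n), Measure.map_map (by fun_prop) (hm (n + 1))]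
    have h1 : (K n ω).map (g n) = (q n ω.down).1.map (f n) := by
      rw [hqK, Measure.map_map (hf n) (hαm n)]
    have h2 : (K (n + 1) ω).map (h (n + 1)) =
        ((q (n + 1) ω.down).1.map (projSucc X n)).map (f n) := by
      rw [hqK, Measure.map_map (hps n) (hαm (n + 1)),
        Measure.map_map (hf n) ((hps n).comp (hαm (n + 1)))]
    rw [hqs, ← h1] at h2
    exact h2.symm
  have hΩ : Nonempty Ω := inferInstance
  obtain ⟨L, hL, hLη, hLae⟩ := exists_chain_kernel η
    (a := fun s => s.1.1) (b := fun s => s.1.2) (by fun_prop) (by fun_prop) hab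
  have hΩc : ¬ Countable Ω := not_countable_iff.2 ‹_›
  have e : Ω ≃ᵐ (ℕ → ((ℕ → ℕ → Bool) × (ℕ → ℕ → Bool)) × Ω) :=
    PolishSpace.measurableEquivOfNotCountable hΩc fun hc =>
      hΩc (Function.Injective.countable
        (f := fun ω : Ω =>
          (fun _ => (default, ω) : ℕ → ((ℕ → ℕ → Bool) × (ℕ → ℕ → Bool)) × Ω))
        fun _ _ h => congrArg Prod.snd (congrFun h 0))
  let β : sample Ω → pi X := fun ω i => α i (e ω i).2 ⟨i, Finset.mem_Iic.2 le_rfl⟩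
  have hβ : β ∈ (pi X).plots := fun i =>
    (X i).comp_mem _ (hα i ⟨i, Finset.mem_Iic.2 le_rfl⟩) (fun ω => (e ω i).2)
      (mem_measurableMaps_of_measurable (by fun_prop))
  have hLM : IsMarkovKernel (L.map e.symm) := Kernel.IsMarkovKernel.map _ e.symm.measurable
  obtain ⟨k, hk, hkL⟩ := exists_plot_of_kernel hβ (L.map e.symm)
  refine ⟨k, hk, fun n ω => Measure.ext fun A hA => ?_⟩
  have hgr (n : ℕ) : ∀ᵐ x ∂L (UC.up ω), (x n).1 = (g n (UC.up (x n).2), h n (UC.up (x n).2)) :=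
    ae_of_ae_map (f := fun x : ℕ → ((ℕ → ℕ → Bool) × (ℕ → ℕ → Bool)) × Ω => x n)
      (p := fun s => s.1 = (g n (UC.up s.2), h n (UC.up s.2)))
      (measurable_pi_apply n).aemeasurable (by
        rw [hLη, hη]
        exact UC.ae_map_graph ((hg n).prodMk (hh n)) _)
  -- Along the chain, the points `α n ω_n` are almost surely compatible.
  have hcomp : ∀ᵐ x ∂L (UC.up ω), ∀ n, projSucc X n (α (n + 1) (x (n + 1)).2) = α n (x n).2 := by
    filter_upwards [ae_all_iff.2 hgr, ae_all_iff.2 fun n => hLae n (UC.up ω)] with x h1 h2 n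
    have h3 := h2 n
    rw [h1 n, h1 (n + 1)] at h3
    exact (hfi n h3).symm
  -- Hence `α n ω_n` agrees with `β` up to level `n`, although each coordinate of `β` is taken at
  -- its own level.
  have hproj_ae : ∀ᵐ x ∂L (UC.up ω), proj X n (β (e.symm x)) = α n (x n).2 := by
    filter_upwards [hcomp] with x hx
    have hx' (n : ℕ) : ∀ i (hi : i ∈ Finset.Iic n),
        α i (x i).2 ⟨i, Finset.mem_Iic.2 le_rfl⟩ = α n (x n).2 ⟨i, hi⟩ := by
      induction n with
      | zero =>
        intro i hi
        obtain rfl : i = 0 := by simpa using hi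
        rfl
      | succ n ih =>
        intro i hi
        rcases (Finset.mem_Iic.1 hi).eq_or_lt with rfl | hlt
        · rfl
        · rw [ih i (Finset.mem_Iic.2 (Nat.lt_succ_iff.1 hlt)), ← hx n]
          rfl
    funext i
    change α i (e (e.symm x) i).2 _ = _
    rw [e.apply_symm_apply]
    exact hx' n i i.2
  have hB : MeasurableSet (UC.down ⁻¹' {ω' : Ω | α n (toSample (UC.up ω')) ∈ A}) :=
    hαm n hA
  have hqn : (q n ω).1 = (K n (UC.up ω)).map (α n ∘ toSample) := hqK n (UC.up ω)
  rw [Measure.map_apply (hproj n) hA, hkL ω _ (hproj n hA), Kernel.map_apply _ e.symm.measurable,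
    MeasurableEquiv.map_apply, hqn, Measure.map_apply (hαm n) hA]
  have hsnd : (L (UC.up ω)).map (fun x => (x n).2) = (K n (UC.up ω)).map UC.down := by
    have h1 := congrArg (Measure.map Prod.snd) (hLη n (UC.up ω))
    rw [hη, Measure.map_map measurable_snd (hm n),
      Measure.map_map measurable_snd (by fun_prop)] at h1
    exact h1
  have := UC.isProbabilityMeasure_map_down (K n (UC.up ω))
  refine Eq.trans ?_ (UC.map_down_apply _ hB)
  have hn := UC.nullMeasurableSet hB ((K n (UC.up ω)).map UC.down)
  rw [← hsnd] at hn ⊢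
  rw [Measure.map_apply₀ (Measurable.aemeasurable (by fun_prop)) hn]
  refine measure_congr ?_
  filter_upwards [hproj_ae] with x hx
  change (proj X n (β (e.symm x)) ∈ A) = (α n (x n).2 ∈ A)
  rw [hx]

end Sample

end QUS

theorem mainTheorem9 {Ω : Type w} [TopologicalSpace Ω] [PolishSpace Ω] [Uncountable Ω]
    (X : ℕ → QUS.{u} Ω) (Z : QUS.{v} Ω)
    (hXZ : (∀ n, (X n).IsUniversal) ∨
      ((∀ n, (X n).IsCountablySeparated) ∧ Z.IsUniversal))
    (Qn : ∀ n, QUS.Hom Z (QUS.P (QUS.upTo X n)))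
    (hQn : ∀ n z, ((Qn (n + 1)).1 z).1.map (QUS.projSucc X n) = ((Qn n).1 z).1) :
    ∃! Q : QUS.Hom Z (QUS.P (QUS.pi X)),
      ∀ n z, (Q.1 z).1.map (QUS.proj X n) = ((Qn n).1 z).1 := by
  borelize Ω
  have hX : ∀ n, (X n).IsCountablySeparated :=
    hXZ.elim (fun h n => (h n).isCountablySeparated) And.left
  have hplot (ζ : Ω → Z) (hζ : ζ ∈ Z.plots) :=
    QUS.exists_plot_pi hX (fun n => (Qn n).1 ∘ ζ) (fun n => (Qn n).2 ζ hζ)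
      (fun n ω => hQn n (ζ ω))
  have hpt (z : Z) : ∃ p : QUS.P (QUS.pi X),
      ∀ n, p.1.map (QUS.proj X n) = ((Qn n).1 z).1 := by
    obtain ⟨k, -, hk⟩ := hplot (fun _ => z) (Z.const_mem z)
    obtain ⟨ω⟩ : Nonempty Ω := inferInstance
    exact ⟨k ω, fun n => hk n ω⟩
  choose Q hQ using hpt
  have hQm : QUS.IsQuasiMeasurable Z (QUS.P (QUS.pi X)) Q := by
    intro ζ hζ
    obtain ⟨k, hk, hkq⟩ := hplot ζ hζ
    have hkQ : Q ∘ ζ = k :=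
      funext fun ω => QUS.P_pi_ext hX fun n => (hQ (ζ ω) n).trans (hkq n ω).symm
    rwa [hkQ]
  refine ⟨⟨Q, hQm⟩, fun n z => hQ z n, fun Q' hQ' => Subtype.ext (funext fun z => ?_)⟩
  exact QUS.P_pi_ext hX fun n => (hQ' n z).trans (hQ z n).symm
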